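/- **Theorem.** For $p=(a,b,c,d,f,\alpha,\beta,\gamma)\in\mathbf C^8$ consider the third order operator of degree (at most) two $$L_p=\theta^3+x(a\theta^3+b\theta^2+c\theta+d)+f x^2(\theta+\alpha)(\theta+\beta)(\theta+\gamma),\qquad \theta=x\tfrac{d}{dx}.$$ Dividing by the leading coefficient $x^3(1+ax+fx^2)$, write it as $y'''+a_2y''+a_1y'+a_0y$ with $a_i\in\mathbf C(x)$, and let $Y\subset\mathbf C^8$ be the set of all $p$ for which the Calabi–Yau condition $$\mathcal W:=\tfrac13a_2''+\tfrac23a_2a_2'+\tfrac4{27}a_2^3+2a_0-\tfrac23a_1a_2-a_1'=0$$ holds identically in $x$. The symmetric group $S_3$ acts on $\mathbf C^8$ by permuting the exponents $\alpha,\beta,\gamma$, which does not change $L_p$; put $\sigma=2\,\frac{\alpha+\beta+\gamma}{3}$. Then $Y$ is an algebraic set, the union of its irreducible components, and $S_3$ permutes these components. Up to this action (that is, up to relabelling the exponents) there are exactly ten irreducible components: the components form exactly ten $S_3$-orbits. Exactly seven of the ten are not contained in $\{f=0\}$. Representatives of these seven can be chosen as follows. 1. The transverse component, on which $\sigma$ is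 not constant (not even on its part with $f\ne0$). It has dimension $3$ and is the family $$\theta^3+\tfrac a4x\bigl(4\theta^3+3(\alpha+\beta)\theta^2+(\alpha+\beta+2\alpha\beta)\theta+\alpha\beta\bigr)+\bigl(\tfrac a2\bigr)^2x^2(\theta+\alpha)\bigl(\theta+\tfrac{\alpha+\beta}2\bigr)(\theta+\beta),\quad a,\alpha,\beta\in\mathbf C.$$ 2. The main component, of dimension $4$, on which $\sigma=2$; it is the family $$\theta^3+x(2\theta+1)\bigl((c-2d)\theta^2+(c-2d)\theta+d\bigr)+fx^2(\theta+\alpha)(\theta+1)(\theta+2-\alpha),\quad c,d,f,\alpha\in\mathbf C.$$ 3. Five further components, on each of which $\sigma$ is constant, with $(\sigma,\dim)=(1,3),\ (3,3),\ (0,2),\ (2,2),\ (4,2)$. -/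

import Mathlib

open MvPolynomial

noncomputable section

namespace CYThird

/-! ### Algebraic sets in affine space over `ℂ` -/

/-- The Zariski topology on `ℂ^ι`: the closed sets are the common zero sets of polynomials. -/
abbrev zariski (ι : Type) : TopologicalSpace (ι → ℂ) :=
  TopologicalSpace.ofClosed {V | ∃ I : Ideal (MvPolynomial ι ℂ), V = zeroLocus ℂ I}
    ⟨⊤, by simp⟩
    (by
      intro A hA
      have hA' : ∀ V ∈ A, ∃ I : Ideal (MvPolynomial ι ℂ), V = zeroLocus ℂ I := fun V hV => hA hV
      choose! J hJ using hA'
      refine ⟨⨆ V ∈ A, J V, ?_⟩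
      have hgc := zeroLocus_vanishingIdeal_galoisConnection (k := ℂ) (K := ℂ) (σ := ι)
      apply Set.Subset.antisymm
      · intro x hx
        have h : (⨆ V ∈ A, J V) ≤ vanishingIdeal ℂ {x} := by
          refine iSup₂_le fun V hV p hp => ?_
          rintro y rfl
          have hy : y ∈ zeroLocus ℂ (J V) := hJ V hV ▸ hx V hV
          exact hy p hp
        intro p hp
        exact h hp x rfl
      · intro x hx V hV
        rw [hJ V hV]
        intro p hp
        exact hx p ((le_iSup₂ (f := fun V (_ : V ∈ A) => J V) V hV) hp))
    (by
      rintro _ ⟨I, rfl⟩ _ ⟨J, rfl⟩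
      refine ⟨I ⊓ J, ?_⟩
      apply Set.Subset.antisymm
      · rintro x (hx | hx) p hp
        · exact hx p hp.1
        · exact hx p hp.2
      · intro x hx
        by_contra hcon
        rw [Set.mem_union, not_or] at hcon
        obtain ⟨h1, h2⟩ := hcon
        simp only [mem_zeroLocus_iff, not_forall] at h1 h2
        obtain ⟨p, hp, hp0⟩ := h1
        obtain ⟨q, hq, hq0⟩ := h2
        have h := hx (p * q) ⟨I.mul_mem_right q hp, J.mul_mem_left p hq⟩
        rw [map_mul] at h
        exact (mul_ne_zero hp0 hq0) h)

/-- The irreducible components of a subset `Y` of `ℂ^ι`: the maximal subsets of `Y` that are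
irreducible in the Zariski topology. -/
def irredComponents {ι : Type} (Y : Set (ι → ℂ)) : Set (Set (ι → ℂ)) :=
  {Z | Maximal (fun S => @IsIrreducible (ι → ℂ) (zariski ι) S ∧ S ⊆ Y) Z}

/-- The dimension of an algebraic set: the Krull dimension of its coordinate ring. -/
def algDim {ι : Type} (Z : Set (ι → ℂ)) : WithBot ℕ∞ :=
  ringKrullDim (MvPolynomial ι ℂ ⧸ vanishingIdeal ℂ Z)

/-! ### The operators

A point `p = (a, b, c, d, f, α, β, γ)` of `ℂ^8` stands for the operator
`θ³ + x(aθ³ + bθ² + cθ + d) + f x²(θ+α)(θ+β)(θ+γ)`, where `θ = x d/dx`. -/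

/-- `θ + s`, acting on functions. -/
def thetaAdd (s : ℂ) (y : ℂ → ℂ) : ℂ → ℂ := fun x => x * deriv y x + s * y x

/-- The operator attached to `p`, acting on functions. -/
def thetaOp (p : Fin 8 → ℂ) (y : ℂ → ℂ) : ℂ → ℂ := fun x =>
  thetaAdd 0 (thetaAdd 0 (thetaAdd 0 y)) x
    + x * (p 0 * thetaAdd 0 (thetaAdd 0 (thetaAdd 0 y)) x + p 1 * thetaAdd 0 (thetaAdd 0 y) x
      + p 2 * thetaAdd 0 y x + p 3 * y x)
    + p 4 * x ^ 2 * thetaAdd (p 5) (thetaAdd (p 6) (thetaAdd (p 7) y)) x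

/-- The coefficient of `θ³` after expansion. -/
def thetaCoeff3 (p : Fin 8 → ℂ) (x : ℂ) : ℂ := 1 + p 0 * x + p 4 * x ^ 2

/-- The coefficient of `θ²` after expansion. -/
def thetaCoeff2 (p : Fin 8 → ℂ) (x : ℂ) : ℂ := p 1 * x + p 4 * (p 5 + p 6 + p 7) * x ^ 2

/-- The coefficient of `θ` after expansion. -/
def thetaCoeff1 (p : Fin 8 → ℂ) (x : ℂ) : ℂ :=
  p 2 * x + p 4 * (p 5 * p 6 + p 5 * p 7 + p 6 * p 7) * x ^ 2

/-- The coefficient of `1` after expansion. -/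
def thetaCoeff0 (p : Fin 8 → ℂ) (x : ℂ) : ℂ := p 3 * x + p 4 * (p 5 * p 6 * p 7) * x ^ 2

/-- The coefficient `a₂` of the monic form `y''' + a₂ y'' + a₁ y' + a₀ y`. -/
def monicCoeff2 (p : Fin 8 → ℂ) (x : ℂ) : ℂ :=
  (3 * thetaCoeff3 p x + thetaCoeff2 p x) / (x * thetaCoeff3 p x)

/-- The coefficient `a₁` of the monic form `y''' + a₂ y'' + a₁ y' + a₀ y`. -/
def monicCoeff1 (p : Fin 8 → ℂ) (x : ℂ) : ℂ :=
  (thetaCoeff3 p x + thetaCoeff2 p x + thetaCoeff1 p x) / (x ^ 2 * thetaCoeff3 p x)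

/-- The coefficient `a₀` of the monic form `y''' + a₂ y'' + a₁ y' + a₀ y`. -/
def monicCoeff0 (p : Fin 8 → ℂ) (x : ℂ) : ℂ :=
  thetaCoeff0 p x / (x ^ 3 * thetaCoeff3 p x)

/-- The monic form is the operator divided by its leading coefficient. -/
theorem thetaOp_eq_monic (p : Fin 8 → ℂ) (y : ℂ → ℂ) (hy : Differentiable ℂ y) (x : ℂ)
    (hx : x ≠ 0) (h3 : thetaCoeff3 p x ≠ 0) :
    thetaOp p y x = x ^ 3 * thetaCoeff3 p x *
      (deriv (deriv (deriv y)) x + monicCoeff2 p x * deriv (deriv y) x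
        + monicCoeff1 p x * deriv y x + monicCoeff0 p x * y x) := by
  have hd : ∀ g : ℂ → ℂ, Differentiable ℂ g → Differentiable ℂ (deriv g) := fun g hg =>
    (hg.contDiff (n := 2)).differentiable_deriv_two
  have h1 := hd y hy
  have h2 := hd _ h1
  have key : ∀ (s : ℂ) (g : ℂ → ℂ), Differentiable ℂ g →
      deriv (thetaAdd s g) = fun z => deriv g z + z * deriv (deriv g) z + s * deriv g z := by
    intro s g hg
    funext z
    have e := (((hasDerivAt_id z).mul (hd g hg z).hasDerivAt).add
      ((hg z).hasDerivAt.const_mul s)).deriv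
    have e' : deriv (thetaAdd s g) z = _ := e
    rw [e']
    simp only [id]
    ring
  have key2 : ∀ (s t : ℂ), deriv (thetaAdd s (thetaAdd t y)) = fun z =>
      (1 + s) * (deriv y z + z * deriv (deriv y) z + t * deriv y z)
        + z * (2 * deriv (deriv y) z + z * deriv (deriv (deriv y)) z + t * deriv (deriv y) z) := by
    intro s t
    have hT : Differentiable ℂ (thetaAdd t y) := by
      unfold thetaAdd
      fun_prop
    rw [key s _ hT, key t y hy]
    funext z
    have e : deriv (fun z => deriv y z + z * deriv (deriv y) z + t * deriv y z) z =
        2 * deriv (deriv y) z + z * deriv (deriv (deriv y)) z + t * deriv (deriv y) z := by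
      have e := (((h1 z).hasDerivAt.add ((hasDerivAt_id z).mul (h2 z).hasDerivAt)).add
        ((h1 z).hasDerivAt.const_mul t)).deriv
      have e' : deriv (fun z => deriv y z + z * deriv (deriv y) z + t * deriv y z) z = _ := e
      rw [e']
      simp only [id]
      ring
    rw [e]
    ring
  have t3 : ∀ r s t : ℂ, thetaAdd r (thetaAdd s (thetaAdd t y)) x =
      x * deriv (thetaAdd s (thetaAdd t y)) x + r * thetaAdd s (thetaAdd t y) x := fun _ _ _ => rfl
  have t2 : ∀ s t : ℂ, thetaAdd s (thetaAdd t y) x =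
      x * deriv (thetaAdd t y) x + s * thetaAdd t y x := fun _ _ => rfl
  have t1 : ∀ t : ℂ, thetaAdd t y x = x * deriv y x + t * y x := fun _ => rfl
  unfold thetaOp monicCoeff2 monicCoeff1 monicCoeff0
  simp only [t3, key2, t2, key _ y hy, t1]
  field_simp
  unfold thetaCoeff3 thetaCoeff2 thetaCoeff1 thetaCoeff0
  ring

/-- The differential polynomial whose vanishing is the Calabi–Yau condition for
`y''' + a₂ y'' + a₁ y' + a₀ y`. -/
def calabiYauW (a₂ a₁ a₀ : ℂ → ℂ) (x : ℂ) : ℂ :=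
  1 / 3 * deriv (deriv a₂) x + 2 / 3 * a₂ x * deriv a₂ x + 4 / 27 * a₂ x ^ 3 + 2 * a₀ x
    - 2 / 3 * a₁ x * a₂ x - deriv a₁ x

/-- The set of parameters for which the rational function `W` vanishes identically, i.e. at
all points that are not among the zeros of its denominator. -/
def Y : Set (Fin 8 → ℂ) :=
  {p | ∀ x : ℂ, x ≠ 0 → thetaCoeff3 p x ≠ 0 →
    calabiYauW (monicCoeff2 p) (monicCoeff1 p) (monicCoeff0 p) x = 0}

/-- The exponents `α, β, γ`. -/
def exponents (p : Fin 8 → ℂ) : Fin 3 → ℂ := ![p 5, p 6, p 7]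

/-- The doubled average exponent. -/
def sigma (p : Fin 8 → ℂ) : ℂ := 2 * ((p 5 + p 6 + p 7) / 3)

/-- Relabelling of the exponents `α, β, γ`; it does not change the operator. -/
def permExponents (π : Equiv.Perm (Fin 3)) (p : Fin 8 → ℂ) : Fin 8 → ℂ :=
  ![p 0, p 1, p 2, p 3, p 4, exponents p (π 0), exponents p (π 1), exponents p (π 2)]

/-- The family
`θ³ + x(2θ+1)((c-2d)θ² + (c-2d)θ + d) + f x²(θ+α)(θ+1)(θ+2-α)`, expanded. -/
def mainFamily : Set (Fin 8 → ℂ) :=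
  {p | ∃ c d f α : ℂ, p = ![2 * (c - 2 * d), 3 * (c - 2 * d), c, d, f, α, 1, 2 - α]}

/-- The family `θ³ + (a/4) x(4θ³ + 3(α+β)θ² + (α+β+2αβ)θ + αβ)
+ (a/2)² x²(θ+α)(θ+(α+β)/2)(θ+β)`, expanded. -/
def transverseFamily : Set (Fin 8 → ℂ) :=
  {p | ∃ a α β : ℂ, p = ![a, a / 4 * (3 * (α + β)), a / 4 * (α + β + 2 * α * β),
    a / 4 * (α * β), (a / 2) ^ 2, α, (α + β) / 2, β]}

end CYThird

end

/-! Write `s`, `q`, `r` for the elementary symmetric functions of the exponents and `A = 1 + ax +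
fx²`. Clearing denominators turns the condition `W = 0` into six polynomial equations in `a, b, c,
d, f, s, q, r` (`calabiYauW_eq`, `mem_Y_iff`), so `Y` is algebraic and invariant under relabelling.

The equations force the local exponents at simple singular points into arithmetic progression. For
`f ≠ 0` the last equation says that one of `α, β, γ` (the exponents at infinity) is the mean of the
other two; relabelling makes it `β`. With `A = (1 - mx)(1 - nx)`, the exponents at a simple root
`1/m` are `0, 1, 2 - l`, where `l` is the residue of `a₂`, hence `l` is `0`, `3/2` or `3`
(`local_exponent_cases`). If `m ≠ n`, the unordered pair of residues `(l, l')` fixes `β = (l +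
l')/3`; the six pairs give the main component and the five others with constant `σ`. If `m = n`, one
remaining equation splits into two factors, giving the main and the transverse family. For `f = 0`
the exponents are free and three equations in `a, b, c, d` yield three more families.

Each of the ten families is parametrized by an affine space through a polynomial map with a
polynomial left inverse (`IsPolyGraph`), hence is closed, irreducible and of known dimension.
Relabelling-invariant equations and sample points exclude inclusions between different families
(`eq_of_perm_component_subset`), and finiteness of `S₃` excludes proper inclusions within one orbit.
The relabelled families are therefore exactly the irreducible components. -/

open scoped Topology

namespace CYThird

/-! ### The Zariski topology on affine space -/

section Zariski

variable {ι κ : Type}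

theorem isClosed_zariski_iff {V : Set (ι → ℂ)} :
    IsClosed[zariski ι] V ↔ ∃ I : Ideal (MvPolynomial ι ℂ), V = zeroLocus ℂ I := by
  rw [← @isOpen_compl_iff _ _ (zariski ι)]
  change Vᶜᶜ ∈ _ ↔ _
  rw [compl_compl]
  rfl

theorem isClosed_zariski_setOf (S : Set (MvPolynomial ι ℂ)) :
    IsClosed[zariski ι] {x : ι → ℂ | ∀ p ∈ S, aeval x p = 0} :=
  isClosed_zariski_iff.2 ⟨Ideal.span S, (zeroLocus_span S).symm⟩

/-- The map of affine spaces whose coordinates are the polynomials `φ`. -/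
noncomputable def polyMap (φ : κ → MvPolynomial ι ℂ) (t : ι → ℂ) : κ → ℂ := fun k => aeval t (φ k)

theorem aeval_polyMap (φ : κ → MvPolynomial ι ℂ) (t : ι → ℂ) (p : MvPolynomial κ ℂ) :
    aeval (polyMap φ t) p = aeval t (aeval φ p) := by
  have h : (aeval (polyMap φ t) : MvPolynomial κ ℂ →ₐ[ℂ] ℂ) = (aeval t).comp (aeval φ) := by
    ext k
    simp [polyMap]
  rw [h]
  rfl

theorem continuous_polyMap (φ : κ → MvPolynomial ι ℂ) :
    @Continuous _ _ (zariski ι) (zariski κ) (polyMap φ) := by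
  let _ := zariski ι
  let _ := zariski κ
  rw [continuous_iff_isClosed]
  intro V hV
  obtain ⟨I, rfl⟩ := isClosed_zariski_iff.1 hV
  have h : polyMap φ ⁻¹' zeroLocus ℂ I = {x | ∀ p ∈ aeval φ '' (I : Set (MvPolynomial κ ℂ)),
      aeval x p = 0} := by
    ext x
    simp [aeval_polyMap]
  rw [h]
  exact isClosed_zariski_setOf _

theorem exists_aeval_ne_zero_of_isOpen {U : Set (ι → ℂ)} (hU : IsOpen[zariski ι] U) {x : ι → ℂ}
    (hx : x ∈ U) : ∃ p : MvPolynomial ι ℂ, aeval x p ≠ 0 ∧ ∀ y, aeval y p ≠ 0 → y ∈ U := by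
  let _ := zariski ι
  obtain ⟨I, hI⟩ := isClosed_zariski_iff.1 (isClosed_compl_iff.2 hU)
  have hx' : x ∉ zeroLocus ℂ I := by
    rw [← hI]
    simpa using hx
  simp only [mem_zeroLocus_iff, not_forall] at hx'
  obtain ⟨p, hp, hp0⟩ := hx'
  refine ⟨p, hp0, fun y hy => ?_⟩
  by_contra hyU
  have hyI : y ∈ zeroLocus ℂ I := hI ▸ hyU
  exact hy (hyI p hp)

/-- Nonempty open sets contain basic opens `p ≠ 0` and `q ≠ 0`; since `ℂ` is infinite, the nonzero
polynomial `p * q` is nonzero at some point. -/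
theorem isIrreducible_univ_zariski : @IsIrreducible (ι → ℂ) (zariski ι) Set.univ := by
  let _ := zariski ι
  refine ⟨⟨0, trivial⟩, ?_⟩
  rintro U V hU hV ⟨x, -, hx⟩ ⟨y, -, hy⟩
  obtain ⟨p, hp, hpU⟩ := exists_aeval_ne_zero_of_isOpen hU hx
  obtain ⟨q, hq, hqV⟩ := exists_aeval_ne_zero_of_isOpen hV hy
  have hpq : p * q ≠ 0 := by
    refine mul_ne_zero ?_ ?_
    · rintro rfl
      simp at hp
    · rintro rfl
      simp at hq
  obtain ⟨z, hz⟩ : ∃ z : ι → ℂ, aeval z (p * q) ≠ 0 := by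
    by_contra! hcon
    exact hpq (MvPolynomial.funext fun z => by simpa [aeval_eq_eval] using hcon z)
  rw [map_mul] at hz
  exact ⟨z, trivial, hpU z (left_ne_zero_of_mul hz), hqV z (right_ne_zero_of_mul hz)⟩

/-- A polynomially embedded affine space: the image of a polynomial map that has a polynomial
left inverse. -/
def IsPolyGraph (κ : Type) (Z : Set (ι → ℂ)) : Prop :=
  ∃ (φ : ι → MvPolynomial κ ℂ) (ψ : κ → MvPolynomial ι ℂ),
    (∀ k, aeval φ (ψ k) = X k) ∧ Z = Set.range (polyMap φ)

theorem polyMap_polyMap_of_leftInverse {φ : ι → MvPolynomial κ ℂ} {ψ : κ → MvPolynomial ι ℂ}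
    (h : ∀ k, aeval φ (ψ k) = X k) (t : κ → ℂ) : polyMap ψ (polyMap φ t) = t := by
  funext k
  rw [polyMap, aeval_polyMap, h, aeval_X]

theorem IsPolyGraph.isIrreducible {Z : Set (ι → ℂ)} (h : IsPolyGraph κ Z) :
    @IsIrreducible _ (zariski ι) Z := by
  obtain ⟨φ, ψ, -, rfl⟩ := h
  let _ := zariski ι
  let _ := zariski κ
  rw [← Set.image_univ]
  exact isIrreducible_univ_zariski.image _ (continuous_polyMap φ).continuousOn

/-- The range is the fixed locus of `polyMap φ ∘ polyMap ψ`, which is cut out by polynomials. -/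
theorem IsPolyGraph.isClosed {Z : Set (ι → ℂ)} (h : IsPolyGraph κ Z) : IsClosed[zariski ι] Z := by
  obtain ⟨φ, ψ, hψ, rfl⟩ := h
  have hZ : Set.range (polyMap φ) =
      {x | ∀ p ∈ Set.range fun i => aeval ψ (φ i) - X i, aeval x p = 0} := by
    ext x
    simp only [Set.mem_range, forall_exists_index, forall_apply_eq_imp_iff, map_sub, aeval_X,
      Set.mem_ofPred_eq, sub_eq_zero]
    constructor
    · rintro ⟨t, rfl⟩ i
      rw [← aeval_polyMap, polyMap_polyMap_of_leftInverse hψ]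
      rfl
    · intro hx
      refine ⟨polyMap ψ x, funext fun i => ?_⟩
      rw [← hx i, ← aeval_polyMap]
      rfl
  rw [hZ]
  exact isClosed_zariski_setOf _

/-- The left inverse makes `aeval φ` surjective, and its kernel is the vanishing ideal, so the
coordinate ring is a polynomial ring. -/
theorem IsPolyGraph.algDim_eq [Finite κ] {Z : Set (ι → ℂ)} (h : IsPolyGraph κ Z) :
    algDim Z = Nat.card κ := by
  obtain ⟨φ, ψ, hψ, rfl⟩ := h
  let F : MvPolynomial ι ℂ →ₐ[ℂ] MvPolynomial κ ℂ := aeval φ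
  have hF : Function.Surjective F := by
    intro q
    refine ⟨aeval ψ q, ?_⟩
    have hc : F.comp (aeval ψ) = AlgHom.id ℂ _ := by
      ext k : 1
      simpa [F] using hψ k
    exact DFunLike.congr_fun hc q
  have hker : vanishingIdeal ℂ (Set.range (polyMap φ)) = RingHom.ker F := by
    ext p
    simp only [mem_vanishingIdeal_iff, Set.forall_mem_range, aeval_polyMap, RingHom.mem_ker]
    constructor
    · intro hp
      exact MvPolynomial.funext fun t => by simpa [F, aeval_eq_eval] using hp t
    · intro hp t
      change aeval t (F p) = 0
      rw [hp, map_zero]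
  rw [algDim, hker,
    ringKrullDim_eq_of_ringEquiv (Ideal.quotientKerAlgEquivOfSurjective hF).toRingEquiv,
    MvPolynomial.ringKrullDim_of_isNoetherianRing, ringKrullDim_eq_zero_of_field, zero_add]

end Zariski

/-! ### Irreducible components of finite unions -/

/-- An irreducible subset of a finite union of closed sets lies in one of them. Maximality is
phrased as `hmax`, not as an antichain condition, because the indexing by pairs (family,
permutation) may repeat sets. -/
theorem irredComponents_iUnion {ι α : Type} [Finite α] (Z : α → Set (ι → ℂ))
    (hirr : ∀ a, @IsIrreducible _ (zariski ι) (Z a)) (hcl : ∀ a, IsClosed[zariski ι] (Z a))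
    (hmax : ∀ a b, Z a ⊆ Z b → Z b ⊆ Z a) :
    irredComponents (⋃ a, Z a) = Set.range Z := by
  let _ := zariski ι
  have key : ∀ S : Set (ι → ℂ), IsIrreducible S → S ⊆ ⋃ a, Z a → ∃ a, S ⊆ Z a := by
    intro S hS hSZ
    have := (isIrreducible_iff_sUnion_isClosed.1 hS) (Set.finite_range Z).toFinset
      (by simpa using hcl) (by simpa using hSZ)
    simpa using this
  ext S
  constructor
  · rintro ⟨⟨hS, hSZ⟩, hm⟩
    obtain ⟨a, ha⟩ := key S hS hSZ
    exact ⟨a, Set.Subset.antisymm (hm ⟨hirr a, Set.subset_iUnion Z a⟩ ha) ha⟩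
  · rintro ⟨a, rfl⟩
    refine ⟨⟨hirr a, Set.subset_iUnion Z a⟩, ?_⟩
    rintro S ⟨hS, hSZ⟩ haS
    obtain ⟨b, hb⟩ := key S hS hSZ
    exact hb.trans (hmax a b (Set.Subset.trans haS hb))

/-! ### The equations of `Y` -/

/-- The coefficients of `27 x³ A³ W`, as a polynomial in `x`, where `A` is the coefficient of `θ³`;
here `s`, `q`, `r` are the elementary symmetric functions of the exponents. -/
def numCoeffs (a b c d f s q r : ℂ) : Fin 6 → ℂ :=
  ![9 * b - 27 * c + 54 * d,
    18 * b ^ 2 - 9 * a * b - 27 * a * c + 108 * a * d - 18 * b * c - 54 * f * q + 54 * f * r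
      + 36 * f * s,
    4 * b ^ 3 + 54 * a ^ 2 * d - 54 * b * f + 108 * d * f - 18 * a * b * c - 81 * a * f * q
      + 108 * a * f * r + 27 * a * f * s - 18 * b * f * q + 54 * b * f * s - 18 * c * f * s,
    -18 * b ^ 2 * f - 54 * f ^ 2 * q + 108 * f ^ 2 * r - 36 * f ^ 2 * s + 36 * f ^ 2 * s ^ 2
      - 9 * a * b * f + 27 * a * c * f + 108 * a * d * f - 27 * a ^ 2 * f * q + 54 * a ^ 2 * f * r
      + 9 * a ^ 2 * f * s - 18 * b * c * f + 12 * b ^ 2 * f * s - 18 * f ^ 2 * q * s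
      - 18 * a * b * f * q + 18 * a * b * f * s - 18 * a * c * f * s,
    9 * b * f ^ 2 + 27 * c * f ^ 2 + 54 * d * f ^ 2 - 27 * a * f ^ 2 * q + 108 * a * f ^ 2 * r
      - 9 * a * f ^ 2 * s + 18 * a * f ^ 2 * s ^ 2 - 18 * b * f ^ 2 * q - 18 * b * f ^ 2 * s
      + 12 * b * f ^ 2 * s ^ 2 - 18 * c * f ^ 2 * s - 18 * a * f ^ 2 * q * s,
    54 * f ^ 3 * r + 4 * f ^ 3 * s ^ 3 - 18 * f ^ 3 * q * s]

/-- The coefficients of `27 x³ A³ W` at the point `p`. -/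
def cyCoeffs (p : Fin 8 → ℂ) : Fin 6 → ℂ :=
  numCoeffs (p 0) (p 1) (p 2) (p 3) (p 4) (p 5 + p 6 + p 7)
    (p 5 * p 6 + p 5 * p 7 + p 6 * p 7) (p 5 * p 6 * p 7)

theorem hasDerivAt_monicCoeff2 (p : Fin 8 → ℂ) {x : ℂ} (hx : x ≠ 0) (hA : thetaCoeff3 p x ≠ 0) :
    HasDerivAt (monicCoeff2 p)
      (((3 * (p 0 + 2 * p 4 * x) + (p 1 + 2 * p 4 * (p 5 + p 6 + p 7) * x))
          * (x * thetaCoeff3 p x)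
        - (3 * thetaCoeff3 p x + thetaCoeff2 p x) * (1 + 2 * p 0 * x + 3 * p 4 * x ^ 2))
        / (x * thetaCoeff3 p x) ^ 2) x := by
  have e1 : HasDerivAt (fun x => 3 * thetaCoeff3 p x + thetaCoeff2 p x)
      (3 * (p 0 + 2 * p 4 * x) + (p 1 + 2 * p 4 * (p 5 + p 6 + p 7) * x)) x := by
    unfold thetaCoeff3 thetaCoeff2
    have := ((((hasDerivAt_id x).const_mul (p 0)).const_add 1).add
      (((hasDerivAt_id x).pow 2).const_mul (p 4))).const_mul 3 |>.add
      (((hasDerivAt_id x).const_mul (p 1)).add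
      (((hasDerivAt_id x).pow 2).const_mul (p 4 * (p 5 + p 6 + p 7))))
    refine this.congr_deriv ?_
    simp
    ring
  have e2 : HasDerivAt (fun x => x * thetaCoeff3 p x) (1 + 2 * p 0 * x + 3 * p 4 * x ^ 2) x := by
    unfold thetaCoeff3
    have := (hasDerivAt_id x).mul ((((hasDerivAt_id x).const_mul (p 0)).const_add 1).add
      (((hasDerivAt_id x).pow 2).const_mul (p 4)))
    refine this.congr_deriv ?_
    simp
    ring
  exact e1.div e2 (mul_ne_zero hx hA)

theorem hasDerivAt_monicCoeff1 (p : Fin 8 → ℂ) {x : ℂ} (hx : x ≠ 0) (hA : thetaCoeff3 p x ≠ 0) :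
    HasDerivAt (monicCoeff1 p)
      ((((p 0 + 2 * p 4 * x) + (p 1 + 2 * p 4 * (p 5 + p 6 + p 7) * x)
          + (p 2 + 2 * p 4 * (p 5 * p 6 + p 5 * p 7 + p 6 * p 7) * x)) * (x ^ 2 * thetaCoeff3 p x)
        - (thetaCoeff3 p x + thetaCoeff2 p x + thetaCoeff1 p x)
          * (2 * x + 3 * p 0 * x ^ 2 + 4 * p 4 * x ^ 3))
        / (x ^ 2 * thetaCoeff3 p x) ^ 2) x := by
  have e1 : HasDerivAt (fun x => thetaCoeff3 p x + thetaCoeff2 p x + thetaCoeff1 p x)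
      ((p 0 + 2 * p 4 * x) + (p 1 + 2 * p 4 * (p 5 + p 6 + p 7) * x)
          + (p 2 + 2 * p 4 * (p 5 * p 6 + p 5 * p 7 + p 6 * p 7) * x)) x := by
    unfold thetaCoeff3 thetaCoeff2 thetaCoeff1
    have := ((((hasDerivAt_id x).const_mul (p 0)).const_add 1).add
      (((hasDerivAt_id x).pow 2).const_mul (p 4))).add
      (((hasDerivAt_id x).const_mul (p 1)).add
      (((hasDerivAt_id x).pow 2).const_mul (p 4 * (p 5 + p 6 + p 7)))) |>.add
      (((hasDerivAt_id x).const_mul (p 2)).add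
      (((hasDerivAt_id x).pow 2).const_mul (p 4 * (p 5 * p 6 + p 5 * p 7 + p 6 * p 7))))
    refine this.congr_deriv ?_
    simp
    ring
  have e2 : HasDerivAt (fun x => x ^ 2 * thetaCoeff3 p x)
      (2 * x + 3 * p 0 * x ^ 2 + 4 * p 4 * x ^ 3) x := by
    unfold thetaCoeff3
    have := ((hasDerivAt_id x).pow 2).mul ((((hasDerivAt_id x).const_mul (p 0)).const_add 1).add
      (((hasDerivAt_id x).pow 2).const_mul (p 4)))
    refine this.congr_deriv ?_
    simp
    ring
  exact e1.div e2 (mul_ne_zero (pow_ne_zero 2 hx) hA)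

theorem hasDerivAt_deriv_monicCoeff2 (p : Fin 8 → ℂ) {x : ℂ} (hx : x ≠ 0)
    (hA : thetaCoeff3 p x ≠ 0) :
    HasDerivAt (deriv (monicCoeff2 p))
      ((((6 * p 4 + 2 * p 4 * (p 5 + p 6 + p 7)) * (x * thetaCoeff3 p x)
        - (3 * thetaCoeff3 p x + thetaCoeff2 p x) * (2 * p 0 + 6 * p 4 * x))
          * (x * thetaCoeff3 p x)
        - 2 * (1 + 2 * p 0 * x + 3 * p 4 * x ^ 2)
          * ((3 * (p 0 + 2 * p 4 * x) + (p 1 + 2 * p 4 * (p 5 + p 6 + p 7) * x))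
            * (x * thetaCoeff3 p x)
          - (3 * thetaCoeff3 p x + thetaCoeff2 p x) * (1 + 2 * p 0 * x + 3 * p 4 * x ^ 2)))
        / (x * thetaCoeff3 p x) ^ 3) x := by
  have hcont : Continuous fun z => z * thetaCoeff3 p z := by
    unfold thetaCoeff3
    fun_prop
  have hev : deriv (monicCoeff2 p) =ᶠ[nhds x] fun x =>
      ((3 * (p 0 + 2 * p 4 * x) + (p 1 + 2 * p 4 * (p 5 + p 6 + p 7) * x))
          * (x * thetaCoeff3 p x)
        - (3 * thetaCoeff3 p x + thetaCoeff2 p x) * (1 + 2 * p 0 * x + 3 * p 4 * x ^ 2))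
        / (x * thetaCoeff3 p x) ^ 2 := by
    filter_upwards [hcont.continuousAt.eventually_ne (mul_ne_zero hx hA)] with z hz
    exact (hasDerivAt_monicCoeff2 p (left_ne_zero_of_mul hz) (right_ne_zero_of_mul hz)).deriv
  refine HasDerivAt.congr_of_eventuallyEq ?_ hev
  have i := hasDerivAt_id x
  have dA : HasDerivAt (thetaCoeff3 p) (p 0 + 2 * p 4 * x) x := by
    refine (((i.const_mul (p 0)).const_add 1).add ((i.pow 2).const_mul (p 4))).congr_deriv ?_
    simp
    ring
  have dP : HasDerivAt (thetaCoeff2 p) (p 1 + 2 * p 4 * (p 5 + p 6 + p 7) * x) x := by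
    refine ((i.const_mul (p 1)).add
      ((i.pow 2).const_mul (p 4 * (p 5 + p 6 + p 7)))).congr_deriv ?_
    simp
    ring
  have dL : HasDerivAt (fun x : ℂ => 3 * (p 0 + 2 * p 4 * x)
      + (p 1 + 2 * p 4 * (p 5 + p 6 + p 7) * x)) (6 * p 4 + 2 * p 4 * (p 5 + p 6 + p 7)) x := by
    refine ((((i.const_mul (2 * p 4)).const_add (p 0)).const_mul 3).add
      ((i.const_mul (2 * p 4 * (p 5 + p 6 + p 7))).const_add (p 1))).congr_deriv ?_
    ring
  have dM : HasDerivAt (fun x : ℂ => 1 + 2 * p 0 * x + 3 * p 4 * x ^ 2)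
      (2 * p 0 + 6 * p 4 * x) x := by
    refine (((i.const_mul (2 * p 0)).const_add 1).add
      ((i.pow 2).const_mul (3 * p 4))).congr_deriv ?_
    simp
    ring
  have dD := i.mul dA
  have hD := mul_ne_zero hx hA
  have hD2 : ((id : ℂ → ℂ) * thetaCoeff3 p) x ^ 2 ≠ 0 := pow_ne_zero 2 hD
  refine (((dL.mul dD).sub (((dA.const_mul 3).add dP).mul dM)).div (dD.pow 2) hD2).congr_deriv ?_
  simp only [Pi.mul_apply, Pi.sub_apply, Pi.add_apply, Pi.pow_apply, id]
  field_simp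
  unfold thetaCoeff3 thetaCoeff2
  ring

/-- The numerator has no constant term: at `x = 0` the operator degenerates to `θ³`, which satisfies
the condition. Hence the shift to `x ^ (k + 1)`. -/
theorem calabiYauW_eq (p : Fin 8 → ℂ) {x : ℂ} (hx : x ≠ 0) (hA : thetaCoeff3 p x ≠ 0) :
    calabiYauW (monicCoeff2 p) (monicCoeff1 p) (monicCoeff0 p) x =
      (∑ k : Fin 6, cyCoeffs p k * x ^ (k.val + 1)) / (27 * (x * thetaCoeff3 p x) ^ 3) := by
  rw [calabiYauW, (hasDerivAt_deriv_monicCoeff2 p hx hA).deriv,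
    (hasDerivAt_monicCoeff2 p hx hA).deriv, (hasDerivAt_monicCoeff1 p hx hA).deriv]
  unfold monicCoeff2 monicCoeff1 monicCoeff0
  field_simp
  simp only [cyCoeffs, numCoeffs, Fin.sum_univ_six]
  unfold thetaCoeff3 thetaCoeff2 thetaCoeff1 thetaCoeff0
  simp
  ring

theorem mem_Y_iff {p : Fin 8 → ℂ} : p ∈ Y ↔ ∀ k, cyCoeffs p k = 0 := by
  constructor
  · intro hp
    let g : Polynomial ℂ :=
      ∑ k : Fin 6, Polynomial.C (cyCoeffs p k) * Polynomial.X ^ (k.val + 1)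
    -- The equation is only known where `x * A ≠ 0`; multiplying by this nonzero polynomial makes
    -- the product vanish everywhere.
    let h : Polynomial ℂ :=
      Polynomial.X * (1 + Polynomial.C (p 0) * Polynomial.X + Polynomial.C (p 4) * Polynomial.X ^ 2)
    have hh : h ≠ 0 := by
      intro h0
      have := congrArg (fun q => Polynomial.coeff q 1) h0
      simp [h, Polynomial.coeff_X_mul, Polynomial.coeff_one] at this
    have hgh : g * h = 0 := by
      refine Polynomial.funext fun x => ?_
      by_cases hx : x * thetaCoeff3 p x = 0
      · have : h.eval x = x * thetaCoeff3 p x := by simp [h, thetaCoeff3]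
        rw [Polynomial.eval_mul, this, hx, mul_zero, Polynomial.eval_zero]
      · have hW := hp x (left_ne_zero_of_mul hx) (right_ne_zero_of_mul hx)
        rw [calabiYauW_eq p (left_ne_zero_of_mul hx) (right_ne_zero_of_mul hx), div_eq_zero_iff,
          or_iff_left (mul_ne_zero (by norm_num) (pow_ne_zero 3 hx))] at hW
        have : g.eval x = 0 := by
          rw [← hW]
          simp [g, Polynomial.eval_finsetSum]
        rw [Polynomial.eval_mul, this, zero_mul, Polynomial.eval_zero]
    have hg : g = 0 := (mul_eq_zero.1 hgh).resolve_right hh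
    intro k
    have := congrArg (fun q => Polynomial.coeff q (k.val + 1)) hg
    simpa [g, Polynomial.finsetSum_coeff, Polynomial.coeff_X_pow, ← Fin.ext_iff] using this
  · intro hp x hx hA
    rw [calabiYauW_eq p hx hA]
    simp [hp]

/-! ### Relabelling the exponents -/

theorem exponents_permExponents (π : Equiv.Perm (Fin 3)) (p : Fin 8 → ℂ) (i : Fin 3) :
    exponents (permExponents π p) i = exponents p (π i) := by
  fin_cases i <;> rfl

theorem permExponents_permExponents (π ρ : Equiv.Perm (Fin 3)) (p : Fin 8 → ℂ) :
    permExponents π (permExponents ρ p) = permExponents (ρ * π) p := by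
  rw [permExponents]
  simp only [exponents_permExponents]
  rfl

theorem permExponents_one (p : Fin 8 → ℂ) : permExponents 1 p = p := by
  funext i
  fin_cases i <;> rfl

theorem permExponents_image_image (π ρ : Equiv.Perm (Fin 3)) (Z : Set (Fin 8 → ℂ)) :
    permExponents π '' (permExponents ρ '' Z) = permExponents (ρ * π) '' Z := by
  rw [Set.image_image]
  simp only [permExponents_permExponents]

theorem permExponents_one_image (Z : Set (Fin 8 → ℂ)) : permExponents 1 '' Z = Z := by
  simp [permExponents_one]

theorem permExponents_image_eq_preimage (π : Equiv.Perm (Fin 3)) (Z : Set (Fin 8 → ℂ)) :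
    permExponents π '' Z = permExponents π⁻¹ ⁻¹' Z := by
  refine congrFun (Set.image_eq_preimage_of_inverse ?_ ?_) Z <;> intro p <;>
    simp [permExponents_permExponents, permExponents_one]

theorem exponents_sum_perm (π : Equiv.Perm (Fin 3)) (p : Fin 8 → ℂ) :
    permExponents π p 5 + permExponents π p 6 + permExponents π p 7 = p 5 + p 6 + p 7 := by
  have h := Equiv.sum_comp π (exponents p)
  simpa [Fin.sum_univ_three, permExponents, exponents] using h

theorem exponents_prod_perm (π : Equiv.Perm (Fin 3)) (p : Fin 8 → ℂ) :
    permExponents π p 5 * permExponents π p 6 * permExponents π p 7 = p 5 * p 6 * p 7 := by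
  have h := Equiv.prod_comp π (exponents p)
  simpa [Fin.prod_univ_three, permExponents, exponents] using h

theorem exponents_pairs_perm (π : Equiv.Perm (Fin 3)) (p : Fin 8 → ℂ) :
    permExponents π p 5 * permExponents π p 6 + permExponents π p 5 * permExponents π p 7
      + permExponents π p 6 * permExponents π p 7 = p 5 * p 6 + p 5 * p 7 + p 6 * p 7 := by
  have h := Equiv.sum_comp π (fun i => exponents p i ^ 2)
  have h' := exponents_sum_perm π p
  have e : permExponents π p 5 ^ 2 + permExponents π p 6 ^ 2 + permExponents π p 7 ^ 2
      = p 5 ^ 2 + p 6 ^ 2 + p 7 ^ 2 := by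
    simpa [Fin.sum_univ_three, permExponents, exponents] using h
  -- Newton's identity: `q` is half of `s²` minus the sum of squares.
  linear_combination (1 / 2) * (permExponents π p 5 + permExponents π p 6 + permExponents π p 7
    + (p 5 + p 6 + p 7)) * h' - 1 / 2 * e

theorem cyCoeffs_permExponents (π : Equiv.Perm (Fin 3)) (p : Fin 8 → ℂ) :
    cyCoeffs (permExponents π p) = cyCoeffs p := by
  rw [cyCoeffs, exponents_sum_perm, exponents_prod_perm, exponents_pairs_perm]
  rfl

theorem permExponents_mem_Y_iff {π : Equiv.Perm (Fin 3)} {p : Fin 8 → ℂ} :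
    permExponents π p ∈ Y ↔ p ∈ Y := by
  rw [mem_Y_iff, mem_Y_iff, cyCoeffs_permExponents]

theorem exists_perm_middle {p : Fin 8 → ℂ}
    (h : (p 5 + p 7 - 2 * p 6) * (p 5 + p 6 - 2 * p 7) * (p 6 + p 7 - 2 * p 5) = 0) :
    ∃ π : Equiv.Perm (Fin 3),
      permExponents π p 5 + permExponents π p 7 = 2 * permExponents π p 6 := by
  rcases mul_eq_zero.1 h with h | h
  · rcases mul_eq_zero.1 h with h | h
    · exact ⟨1, by simpa [permExponents_one] using sub_eq_zero.1 h⟩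
    · refine ⟨Equiv.swap 1 2, ?_⟩
      have : permExponents (Equiv.swap 1 2) p 5 + permExponents (Equiv.swap 1 2) p 7
        - 2 * permExponents (Equiv.swap 1 2) p 6 = p 5 + p 6 - 2 * p 7 := rfl
      rw [← sub_eq_zero, this, h]
  · refine ⟨Equiv.swap 0 1, ?_⟩
    have : permExponents (Equiv.swap 0 1) p 5 + permExponents (Equiv.swap 0 1) p 7
      - 2 * permExponents (Equiv.swap 0 1) p 6 = p 6 + p 7 - 2 * p 5 := rfl
    rw [← sub_eq_zero, this, h]

/-! ### The components -/

/-- The operators `(1 + mx)(θ³ + x(2θ+1)(kθ² + kθ + kα(1-α)))`. -/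
def leftHalfFamily : Set (Fin 8 → ℂ) :=
  {p | ∃ m k α : ℂ, p = ![m + 2 * k, 3 * k, k + 2 * (k * (α * (1 - α))), k * (α * (1 - α)),
    2 * m * k, α, 1 / 2, 1 - α]}

/-- The operators `(θ³ + x(2θ+1)(kθ² + kθ + k(α-1)(2-α)))(1 + mx)`. -/
def rightHalfFamily : Set (Fin 8 → ℂ) :=
  {p | ∃ m k α : ℂ, p = ![m + 2 * k, 3 * k + 3 * m, k + 2 * (k * ((α - 1) * (2 - α))) + 3 * m,
    k * ((α - 1) * (2 - α)) + m, 2 * m * k, α, 3 / 2, 3 - α]}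

/-- The operators `(1 + ax + fx²)θ³`. -/
def leftCubeFamily : Set (Fin 8 → ℂ) :=
  {p | ∃ a f : ℂ, p = ![a, 0, 0, 0, f, 0, 0, 0]}

/-- The operators `(1 + mx)θ³(1 + nx)`. -/
def midCubeFamily : Set (Fin 8 → ℂ) :=
  {p | ∃ m n : ℂ, p = ![m + n, 3 * n, 3 * n, n, m * n, 1, 1, 1]}

/-- The operators `θ³(1 + ax + fx²)`. -/
def rightCubeFamily : Set (Fin 8 → ℂ) :=
  {p | ∃ a f : ℂ, p = ![a, 3 * a, 3 * a, a, f, 2, 2, 2]}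

/-- The operators `θ³ + x(2θ+1)(kθ² + kθ + d)`, with arbitrary exponents. -/
def hypergeomFamily : Set (Fin 8 → ℂ) :=
  {p | ∃ k d α β γ : ℂ, p = ![2 * k, 3 * k, k + 2 * d, d, 0, α, β, γ]}

/-- The operators `(1 + ax)θ³`, with arbitrary exponents. -/
def leftCubeLinearFamily : Set (Fin 8 → ℂ) :=
  {p | ∃ a α β γ : ℂ, p = ![a, 0, 0, 0, 0, α, β, γ]}

/-- The operators `θ³(1 + ax)`, with arbitrary exponents. -/
def rightCubeLinearFamily : Set (Fin 8 → ℂ) :=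
  {p | ∃ a α β γ : ℂ, p = ![a, 3 * a, 3 * a, a, 0, α, β, γ]}

/-- Representatives of the irreducible components of `Y` up to relabelling. -/
def component : Fin 10 → Set (Fin 8 → ℂ) :=
  ![transverseFamily, mainFamily, leftHalfFamily, rightHalfFamily, leftCubeFamily, midCubeFamily,
    rightCubeFamily, hypergeomFamily, leftCubeLinearFamily, rightCubeLinearFamily]

theorem component_subset_Y (i : Fin 10) : component i ⊆ Y := by
  intro p hp
  rw [mem_Y_iff]
  fin_cases i
  · obtain ⟨a, α, β, rfl⟩ := hp
    intro k; fin_cases k <;> simp [cyCoeffs, numCoeffs] <;> ring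
  · obtain ⟨c, d, f, α, rfl⟩ := hp
    intro k; fin_cases k <;> simp [cyCoeffs, numCoeffs] <;> ring
  · obtain ⟨m, k, α, rfl⟩ := hp
    intro k; fin_cases k <;> simp [cyCoeffs, numCoeffs] <;> ring
  · obtain ⟨m, k, α, rfl⟩ := hp
    intro k; fin_cases k <;> simp [cyCoeffs, numCoeffs] <;> ring
  · obtain ⟨a, f, rfl⟩ := hp
    intro k; fin_cases k <;> simp [cyCoeffs, numCoeffs]
  · obtain ⟨m, n, rfl⟩ := hp
    intro k; fin_cases k <;> simp [cyCoeffs, numCoeffs] <;> ring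
  · obtain ⟨a, f, rfl⟩ := hp
    intro k; fin_cases k <;> simp [cyCoeffs, numCoeffs] <;> ring
  · obtain ⟨k, d, α, β, γ, rfl⟩ := hp
    intro k; fin_cases k <;> simp [cyCoeffs, numCoeffs] <;> ring
  · obtain ⟨a, α, β, γ, rfl⟩ := hp
    intro k; fin_cases k <;> simp [cyCoeffs, numCoeffs]
  · obtain ⟨a, α, β, γ, rfl⟩ := hp
    intro k; fin_cases k <;> simp [cyCoeffs, numCoeffs] <;> ring

/-! ### Solving the equations -/

theorem vec8_ext {p : Fin 8 → ℂ} {a b c d f α β γ : ℂ} (h0 : p 0 = a) (h1 : p 1 = b)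
    (h2 : p 2 = c) (h3 : p 3 = d) (h4 : p 4 = f) (h5 : p 5 = α) (h6 : p 6 = β) (h7 : p 7 = γ) :
    p = ![a, b, c, d, f, α, β, γ] := by
  subst h0 h1 h2 h3 h4 h5 h6 h7
  funext i
  fin_cases i <;> rfl

/-- For `f = 0` the exponents drop out. The first equation gives `c`, the second becomes `(2b -
3a)(b - 3d) = 0`, and for `b = 3d` the third becomes `d(2d - a)(d - a) = 0`. The root `2d = a` falls
back into the case `2b = 3a`. -/
theorem exists_component_of_f_eq_zero {p : Fin 8 → ℂ} (hp : p ∈ Y) (hf : p 4 = 0) :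
    ∃ i, p ∈ component i := by
  rw [mem_Y_iff] at hp
  have e1 := hp 0
  have e2 := hp 1
  have e3 := hp 2
  simp [cyCoeffs, numCoeffs, hf] at e1 e2 e3
  have hc : p 2 = 2 * p 3 + p 1 / 3 := by linear_combination -e1 / 27
  rw [hc] at e2 e3
  have h2 : (2 * p 1 - 3 * p 0) * (p 1 - 3 * p 3) = 0 := by linear_combination e2 / 6
  rcases mul_eq_zero.1 h2 with h | h
  · refine ⟨7, p 0 / 2, p 3, p 5, p 6, p 7, vec8_ext ?_ ?_ ?_ rfl hf rfl rfl rfl⟩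
    · ring
    · linear_combination h / 2
    · linear_combination hc + h / 6
  · have h1 : p 1 = 3 * p 3 := sub_eq_zero.1 h
    rw [h1] at e3
    have h3 : p 3 * ((2 * p 3 - p 0) * (p 3 - p 0)) = 0 := by linear_combination e3 / 54
    rcases mul_eq_zero.1 h3 with h3 | h3
    · exact ⟨8, p 0, p 5, p 6, p 7, vec8_ext rfl (by rw [h1, h3, mul_zero])
        (by rw [hc, h1, h3]; ring) h3 hf rfl rfl rfl⟩
    rcases mul_eq_zero.1 h3 with h3 | h3
    · refine ⟨7, p 0 / 2, p 3, p 5, p 6, p 7, vec8_ext ?_ ?_ ?_ rfl hf rfl rfl rfl⟩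
      · ring
      · linear_combination h + 3 / 2 * h3
      · linear_combination hc + h / 3 + h3 / 2
    · have h3 : p 3 = p 0 := sub_eq_zero.1 h3
      exact ⟨9, p 0, p 5, p 6, p 7, vec8_ext rfl (by rw [h1, h3])
        (by rw [hc, h1, h3]; ring) h3 hf rfl rfl rfl⟩

/-- The local exponent condition at the root `1 / m` of `(1 - m x) (1 - n x)`. -/
theorem local_exponent_cases {m n b c d s q r : ℂ} (hm : m ≠ 0)
    (h : ∀ k, numCoeffs (-(m + n)) b c d (m * n) s q r k = 0) :
    ∃ l : ℂ, (l = 0 ∨ l = 3 / 2 ∨ l = 3) ∧ b + n * s = l * (n - m) := by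
  have e1 := h 0
  have e2 := h 1
  have e3 := h 2
  have e4 := h 3
  have e5 := h 4
  have e6 := h 5
  simp [numCoeffs] at e1 e2 e3 e4 e5 e6
  -- This combination is `m ^ 6 / 4` times the numerator at `x = 1 / m`. For `m ≠ n` the number `l`
  -- is the residue of `a₂` there, and the three factors express that one of the local exponents `0,
  -- 1, 2 - l` is the mean of the other two.
  have key : m ^ 3 * ((b + n * s) * ((b + n * s - 3 * (n - m)) *
      (b + n * s - 3 / 2 * (n - m)))) = 0 := by
    linear_combination (e1 * m ^ 5 + e2 * m ^ 4 + e3 * m ^ 3 + e4 * m ^ 2 + e5 * m + e6) / 4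
  rcases mul_eq_zero.1 ((mul_eq_zero.1 key).resolve_left (pow_ne_zero 3 hm)) with h | h
  · exact ⟨0, .inl rfl, by rw [h, zero_mul]⟩
  · rcases mul_eq_zero.1 h with h | h
    · exact ⟨3, .inr (.inr rfl), sub_eq_zero.1 h⟩
    · exact ⟨3 / 2, .inr (.inl rfl), sub_eq_zero.1 h⟩

theorem eq_and_eq_of_add_of_mul {x y z : ℂ} (h : x + y = 2 * z) (h' : x * y = z ^ 2) :
    x = z ∧ y = z := by
  have hx : (x - z) ^ 2 = 0 := by linear_combination x * h - h'
  have hx : x = z := sub_eq_zero.1 (pow_eq_zero_iff two_ne_zero |>.1 hx)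
  exact ⟨hx, by linear_combination h - hx⟩

theorem exists_component_of_distinct_roots {p : Fin 8 → ℂ} {m n l l' : ℂ}
    (hp : ∀ k, cyCoeffs p k = 0) (hm : m ≠ 0) (hn : n ≠ 0) (hmn : m ≠ n)
    (ha : p 0 = -(m + n)) (hf : p 4 = m * n) (hmid : p 5 + p 7 = 2 * p 6)
    (hl : p 1 + n * (p 5 + p 6 + p 7) = l * (n - m))
    (hl' : p 1 + m * (p 5 + p 6 + p 7) = l' * (m - n))
    (hll : (l = 0 ∧ l' = 0) ∨ (l = 0 ∧ l' = 3) ∨ (l = 3 ∧ l' = 3) ∨ (l = 0 ∧ l' = 3 / 2) ∨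
      (l = 3 ∧ l' = 3 / 2) ∨ (l = 3 / 2 ∧ l' = 3 / 2)) :
    ∃ i, p ∈ component i := by
  have hmn' : m - n ≠ 0 := sub_ne_zero.2 hmn
  -- Subtracting the residue equations gives `s = l + l'`, while `hmid` gives `s = 3β`.
  have h6 : p 6 = (l + l') / 3 := by
    refine mul_left_cancel₀ hmn' ?_
    linear_combination (hl' - hl - (m - n) * hmid) / 3
  have h7 : p 7 = 2 * ((l + l') / 3) - p 5 := by rw [← h6]; linear_combination hmid
  have hb : p 1 = -(l * m + l' * n) := by
    rw [h6, h7] at hl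
    linear_combination hl
  have e1 := hp 0
  have e2 := hp 1
  have e3 := hp 2
  have e5 := hp 4
  simp [cyCoeffs, numCoeffs] at e1 e2 e3 e5
  have hc : p 2 = 2 * p 3 + p 1 / 3 := by linear_combination -e1 / 27
  rw [hb] at hc
  rw [ha, hb, hc, hf, h6, h7] at e2 e3 e5
  -- A root with residue `0` splits off as a left factor `1 - mx`, one with residue `3` as a right
  -- factor; residue `3/2` occurs in the factors containing `2θ + 1`.
  rcases hll with ⟨rfl, rfl⟩ | ⟨rfl, rfl⟩ | ⟨rfl, rfl⟩ | ⟨rfl, rfl⟩ | ⟨rfl, rfl⟩ | ⟨rfl, rfl⟩ <;>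
    norm_num at hb hc h6 h7
  · have hd : p 3 = 0 := by
      have : (m - n) ^ 2 * p 3 = 0 := by linear_combination -(e3 + 3 / 2 * (m + n) * e2) / 27
      exact (mul_eq_zero.1 this).resolve_left (pow_ne_zero 2 hmn')
    have hw : p 5 * p 7 = 0 := by
      have : m * n * (p 5 * p 7) = 0 := by
        rw [h7]
        linear_combination -e2 / 54 - (m + n) * hd
      exact (mul_eq_zero.1 this).resolve_left (mul_ne_zero hm hn)
    obtain ⟨h5, h7⟩ := eq_and_eq_of_add_of_mul (z := 0) (by rw [hmid, h6]) (by rw [hw]; ring)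
    exact ⟨4, p 0, p 4, vec8_ext rfl hb (by rw [hc, hd, mul_zero]) hd rfl h5 h6 h7⟩
  · have hd : p 3 = -n := by
      have : (m - n) * (p 3 + n) = 0 := by linear_combination -e2 / 54
      linear_combination (mul_eq_zero.1 this).resolve_left hmn'
    have hw : p 5 * p 7 = 1 := by
      have : (m * n) ^ 2 * (m - n) * (p 5 * p 7 - 1) = 0 := by
        rw [h7]
        linear_combination -e5 / 27
      linear_combination (mul_eq_zero.1 this).resolve_left
        (mul_ne_zero (pow_ne_zero 2 (mul_ne_zero hm hn)) hmn')
    obtain ⟨h5, h7⟩ := eq_and_eq_of_add_of_mul (z := 1) (by rw [hmid, h6]) (by rw [hw]; ring)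
    exact ⟨5, -m, -n, vec8_ext (by rw [ha]; ring) (by rw [hb]; ring) (by rw [hc, hd]; ring) hd
      (by rw [hf]; ring) h5 h6 h7⟩
  · have k5 : 4 * (p 3 + (m + n)) + (m + n) * (p 5 * p 7 - 4) = 0 := by
      have : (m * n) ^ 2 * (4 * (p 3 + (m + n)) + (m + n) * (p 5 * p 7 - 4)) = 0 := by
        rw [h7]
        linear_combination -e5 / 27
      exact (mul_eq_zero.1 this).resolve_left (pow_ne_zero 2 (mul_ne_zero hm hn))
    have hw : p 5 * p 7 = 4 := by
      have : (m - n) ^ 2 * (p 5 * p 7 - 4) = 0 := by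
        rw [h7] at k5 ⊢
        linear_combination (m + n) * k5 - 2 * e2 / 27
      linear_combination (mul_eq_zero.1 this).resolve_left (pow_ne_zero 2 hmn')
    have hd : p 3 = -(m + n) := by linear_combination k5 / 4 - (m + n) / 4 * hw
    obtain ⟨h5, h7⟩ := eq_and_eq_of_add_of_mul (z := 2) (by rw [hmid, h6]) (by rw [hw]; ring)
    exact ⟨6, p 0, p 4, vec8_ext rfl (by rw [hb, ha]; ring) (by rw [hc, hd, ha]; ring)
      (by rw [hd, ha]) rfl h5 h6 h7⟩
  · have hd : p 3 = -(n / 2) * (p 5 * (1 - p 5)) := by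
      have : m * (2 * p 3 + n * (p 5 * (1 - p 5))) = 0 := by linear_combination -e2 / 27
      linear_combination (mul_eq_zero.1 this).resolve_left hm / 2
    exact ⟨2, -m, -(n / 2), p 5, vec8_ext (by rw [ha]; ring) (by rw [hb]; ring)
      (by rw [hc, hd]; ring) hd (by rw [hf]; ring) rfl h6 h7⟩
  · have hd : p 3 = -(n / 2) * ((p 5 - 1) * (2 - p 5)) + -m := by
      have : m * (2 * p 3 + 2 * m - 2 * n + n * (p 5 * (3 - p 5))) = 0 := by
        linear_combination e2 / 27
      linear_combination (mul_eq_zero.1 this).resolve_left hm / 2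
    exact ⟨3, -m, -(n / 2), p 5, vec8_ext (by rw [ha]; ring) (by rw [hb]; ring)
      (by rw [hc, hd]; ring) hd (by rw [hf]; ring) rfl h6 h7⟩
  · exact ⟨1, p 2, p 3, p 4, p 5, vec8_ext (by rw [hc, ha]; ring) (by rw [hc, hb]; ring) rfl rfl rfl
      rfl h6 h7⟩

/-- After substitution the second equation is `m(β - 1)(2d + mαγ) = 0`: the factor `β - 1` gives the
main family, the other one the transverse family. -/
theorem exists_component_of_double_root {p : Fin 8 → ℂ} {m : ℂ} (hp : ∀ k, cyCoeffs p k = 0)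
    (hm : m ≠ 0) (ha : p 0 = -(m + m)) (hf : p 4 = m * m) (hmid : p 5 + p 7 = 2 * p 6)
    (hb : p 1 + m * (p 5 + p 6 + p 7) = 0) : ∃ i, p ∈ component i := by
  have h7 : p 7 = 2 * p 6 - p 5 := by linear_combination hmid
  have hb : p 1 = -3 * m * p 6 := by linear_combination hb - m * hmid
  have e1 := hp 0
  have e2 := hp 1
  simp [cyCoeffs, numCoeffs] at e1 e2
  have hc : p 2 = 2 * p 3 + p 1 / 3 := by linear_combination -e1 / 27
  rw [hb] at hc
  rw [ha, hb, hc, hf, h7] at e2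
  have key : m * ((p 6 - 1) * (2 * p 3 + m * (p 5 * p 7))) = 0 := by
    rw [h7]
    linear_combination e2 / 54
  rcases mul_eq_zero.1 ((mul_eq_zero.1 key).resolve_left hm) with h | h
  · have h6 : p 6 = 1 := sub_eq_zero.1 h
    exact ⟨1, p 2, p 3, p 4, p 5, vec8_ext (by rw [hc, ha, h6]; ring) (by rw [hc, hb, h6]; ring)
      rfl rfl rfl rfl h6 (by rw [h7, h6, mul_one])⟩
  · refine ⟨0, p 0, p 5, p 7, vec8_ext rfl ?_ ?_ ?_ ?_ rfl ?_ rfl⟩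
    · rw [hb, ha, hmid]
      ring
    · rw [hc, ha]
      linear_combination h + m / 2 * hmid
    · rw [ha]
      linear_combination h / 2
    · rw [hf, ha]
      ring
    · linear_combination -hmid / 2

theorem exists_component_of_middle {p : Fin 8 → ℂ} (hp : p ∈ Y) (hf : p 4 ≠ 0)
    (hmid : p 5 + p 7 = 2 * p 6) : ∃ i, p ∈ component i := by
  rw [mem_Y_iff] at hp
  -- A square root of the discriminant factors `A` as `(1 - mx)(1 - nx)`.
  obtain ⟨z, hz⟩ := IsAlgClosed.exists_pow_nat_eq (p 0 ^ 2 - 4 * p 4) (n := 2) two_pos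
  obtain ⟨m, hm⟩ : ∃ m, m = (z - p 0) / 2 := ⟨_, rfl⟩
  obtain ⟨n, hn⟩ : ∃ n, n = (-z - p 0) / 2 := ⟨_, rfl⟩
  have ha : p 0 = -(m + n) := by rw [hm, hn]; ring
  have hf' : p 4 = m * n := by rw [hm, hn]; linear_combination hz / 4
  have hm0 : m ≠ 0 := by rintro rfl; simp [hf'] at hf
  have hn0 : n ≠ 0 := by rintro rfl; simp [hf'] at hf
  obtain ⟨l, hl, hl1⟩ := local_exponent_cases (m := m) (n := n) hm0 (by rw [← ha, ← hf']; exact hp)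
  obtain ⟨l', hl', hl1'⟩ := local_exponent_cases (m := n) (n := m) hn0
    (by rw [add_comm n m, mul_comm n m, ← ha, ← hf']; exact hp)
  by_cases hmn : m = n
  · subst hmn
    exact exists_component_of_double_root hp hm0 ha hf' hmid (by rw [hl1, sub_self, mul_zero])
  · have key := exists_component_of_distinct_roots hp hm0 hn0 hmn ha hf' hmid hl1 hl1'
    have key' := exists_component_of_distinct_roots hp hn0 hm0 (Ne.symm hmn) (by rw [ha, add_comm])
      (by rw [hf', mul_comm]) hmid hl1' hl1
    -- Of the nine ordered pairs, those not listed in the six cases of `key` are covered after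
    -- exchanging `m` and `n`.
    rcases hl with rfl | rfl | rfl <;> rcases hl' with rfl | rfl | rfl <;>
      first
      | (refine key ?_; norm_num; done)
      | (refine key' ?_; norm_num)

theorem Y_eq_iUnion : Y = ⋃ x : Fin 10 × Equiv.Perm (Fin 3), permExponents x.2 '' component x.1 := by
  ext p
  simp only [Set.mem_iUnion]
  constructor
  · intro hp
    by_cases hf : p 4 = 0
    · obtain ⟨i, hi⟩ := exists_component_of_f_eq_zero hp hf
      exact ⟨(i, 1), p, hi, permExponents_one p⟩
    · have h6 := mem_Y_iff.1 hp 5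
      simp [cyCoeffs, numCoeffs] at h6
      -- The last coefficient is `-2f³` times the product of the three differences such as `α + γ -
      -- 2β`.
      obtain ⟨π, hπ⟩ := exists_perm_middle (p := p) (by
        have : p 4 ^ 3 * ((p 5 + p 7 - 2 * p 6) * (p 5 + p 6 - 2 * p 7) * (p 6 + p 7 - 2 * p 5))
            = 0 := by linear_combination (-1 / 2 : ℂ) * h6
        exact (mul_eq_zero.1 this).resolve_left (pow_ne_zero 3 hf))
      obtain ⟨i, hi⟩ := exists_component_of_middle (p := permExponents π p)
        (permExponents_mem_Y_iff.2 hp) hf hπ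
      refine ⟨(i, π⁻¹), _, hi, ?_⟩
      rw [permExponents_permExponents, mul_inv_cancel, permExponents_one]
  · rintro ⟨⟨i, π⟩, q, hq, rfl⟩
    exact permExponents_mem_Y_iff.2 (component_subset_Y i hq)

/-! ### The components are polynomially embedded affine spaces -/

/-- Polynomials over `ℂ` are determined by their values, so the left inverse may be checked at
points. -/
theorem isPolyGraph_of_leftInverse {ι κ : Type} {Z : Set (ι → ℂ)} (φ : ι → MvPolynomial κ ℂ)
    (ψ : κ → MvPolynomial ι ℂ) (hψ : ∀ t, polyMap ψ (polyMap φ t) = t)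
    (hZ : Z = Set.range (polyMap φ)) : IsPolyGraph κ Z := by
  refine ⟨φ, ψ, fun k => MvPolynomial.funext fun t => ?_, hZ⟩
  have h := congrFun (hψ t) k
  rw [polyMap, aeval_polyMap] at h
  simpa [aeval_eq_eval] using h

theorem isPolyGraph_transverseFamily : IsPolyGraph (Fin 3) transverseFamily := by
  refine isPolyGraph_of_leftInverse
    ![X 0, C (1 / 4) * X 0 * (3 * (X 1 + X 2)), C (1 / 4) * X 0 * (X 1 + X 2 + 2 * X 1 * X 2),
      C (1 / 4) * X 0 * (X 1 * X 2), (C (1 / 2) * X 0) ^ 2, X 1, C (1 / 2) * (X 1 + X 2), X 2]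
    ![X 0, X 5, X 7] (fun t => ?_) ?_
  · funext k
    fin_cases k <;> simp [polyMap]
  · ext p
    constructor
    · rintro ⟨a, α, β, rfl⟩
      refine ⟨![a, α, β], vec8_ext ?_ ?_ ?_ ?_ ?_ ?_ ?_ ?_⟩ <;>
        simp [polyMap] <;> first | ring1 | (left; ring1)
    · rintro ⟨t, rfl⟩
      refine ⟨t 0, t 1, t 2, vec8_ext ?_ ?_ ?_ ?_ ?_ ?_ ?_ ?_⟩ <;>
        simp [polyMap] <;> first | ring1 | (left; ring1)

theorem isPolyGraph_mainFamily : IsPolyGraph (Fin 4) mainFamily := by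
  refine isPolyGraph_of_leftInverse
    ![2 * (X 0 - 2 * X 1), 3 * (X 0 - 2 * X 1), X 0, X 1, X 2, X 3, 1, 2 - X 3]
    ![X 2, X 3, X 4, X 5] (fun t => ?_) ?_
  · funext k
    fin_cases k <;> simp [polyMap]
  · ext p
    constructor
    · rintro ⟨c, d, f, α, rfl⟩
      refine ⟨![c, d, f, α], vec8_ext ?_ ?_ ?_ ?_ ?_ ?_ ?_ ?_⟩ <;> simp [polyMap]
    · rintro ⟨t, rfl⟩
      refine ⟨t 0, t 1, t 2, t 3, vec8_ext ?_ ?_ ?_ ?_ ?_ ?_ ?_ ?_⟩ <;> simp [polyMap]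

theorem isPolyGraph_leftHalfFamily : IsPolyGraph (Fin 3) leftHalfFamily := by
  refine isPolyGraph_of_leftInverse
    ![X 0 + 2 * X 1, 3 * X 1, X 1 + 2 * (X 1 * (X 2 * (1 - X 2))), X 1 * (X 2 * (1 - X 2)),
      2 * X 0 * X 1, X 2, C (1 / 2), 1 - X 2]
    ![X 0 - C (2 / 3) * X 1, C (1 / 3) * X 1, X 5] (fun t => ?_) ?_
  · funext k
    fin_cases k <;> simp [polyMap]
    ring
  · ext p
    constructor
    · rintro ⟨m, k, α, rfl⟩
      refine ⟨![m, k, α], vec8_ext ?_ ?_ ?_ ?_ ?_ ?_ ?_ ?_⟩ <;> simp [polyMap]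
    · rintro ⟨t, rfl⟩
      refine ⟨t 0, t 1, t 2, vec8_ext ?_ ?_ ?_ ?_ ?_ ?_ ?_ ?_⟩ <;> simp [polyMap]

theorem isPolyGraph_rightHalfFamily : IsPolyGraph (Fin 3) rightHalfFamily := by
  refine isPolyGraph_of_leftInverse
    ![X 0 + 2 * X 1, 3 * X 1 + 3 * X 0, X 1 + 2 * (X 1 * ((X 2 - 1) * (2 - X 2))) + 3 * X 0,
      X 1 * ((X 2 - 1) * (2 - X 2)) + X 0, 2 * X 0 * X 1, X 2, C (3 / 2), 3 - X 2]
    ![C (2 / 3) * X 1 - X 0, X 0 - C (1 / 3) * X 1, X 5] (fun t => ?_) ?_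
  · funext k
    fin_cases k <;> simp [polyMap] <;> ring
  · ext p
    constructor
    · rintro ⟨m, k, α, rfl⟩
      refine ⟨![m, k, α], vec8_ext ?_ ?_ ?_ ?_ ?_ ?_ ?_ ?_⟩ <;> simp [polyMap]
    · rintro ⟨t, rfl⟩
      refine ⟨t 0, t 1, t 2, vec8_ext ?_ ?_ ?_ ?_ ?_ ?_ ?_ ?_⟩ <;> simp [polyMap]

theorem isPolyGraph_leftCubeFamily : IsPolyGraph (Fin 2) leftCubeFamily := by
  refine isPolyGraph_of_leftInverse ![X 0, 0, 0, 0, X 1, 0, 0, 0] ![X 0, X 4] (fun t => ?_) ?_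
  · funext k
    fin_cases k <;> simp [polyMap]
  · ext p
    constructor
    · rintro ⟨a, f, rfl⟩
      refine ⟨![a, f], vec8_ext ?_ ?_ ?_ ?_ ?_ ?_ ?_ ?_⟩ <;> simp [polyMap]
    · rintro ⟨t, rfl⟩
      refine ⟨t 0, t 1, vec8_ext ?_ ?_ ?_ ?_ ?_ ?_ ?_ ?_⟩ <;> simp [polyMap]

theorem isPolyGraph_midCubeFamily : IsPolyGraph (Fin 2) midCubeFamily := by
  refine isPolyGraph_of_leftInverse ![X 0 + X 1, 3 * X 1, 3 * X 1, X 1, X 0 * X 1, 1, 1, 1]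
    ![X 0 - X 3, X 3] (fun t => ?_) ?_
  · funext k
    fin_cases k <;> simp [polyMap]
  · ext p
    constructor
    · rintro ⟨m, n, rfl⟩
      refine ⟨![m, n], vec8_ext ?_ ?_ ?_ ?_ ?_ ?_ ?_ ?_⟩ <;> simp [polyMap]
    · rintro ⟨t, rfl⟩
      refine ⟨t 0, t 1, vec8_ext ?_ ?_ ?_ ?_ ?_ ?_ ?_ ?_⟩ <;> simp [polyMap]

theorem isPolyGraph_rightCubeFamily : IsPolyGraph (Fin 2) rightCubeFamily := by
  refine isPolyGraph_of_leftInverse ![X 0, 3 * X 0, 3 * X 0, X 0, X 1, 2, 2, 2]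
    ![X 0, X 4] (fun t => ?_) ?_
  · funext k
    fin_cases k <;> simp [polyMap]
  · ext p
    constructor
    · rintro ⟨a, f, rfl⟩
      refine ⟨![a, f], vec8_ext ?_ ?_ ?_ ?_ ?_ ?_ ?_ ?_⟩ <;> simp [polyMap]
    · rintro ⟨t, rfl⟩
      refine ⟨t 0, t 1, vec8_ext ?_ ?_ ?_ ?_ ?_ ?_ ?_ ?_⟩ <;> simp [polyMap]

theorem isPolyGraph_hypergeomFamily : IsPolyGraph (Fin 5) hypergeomFamily := by
  refine isPolyGraph_of_leftInverse
    ![2 * X 0, 3 * X 0, X 0 + 2 * X 1, X 1, 0, X 2, X 3, X 4]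
    ![X 1 - X 0, X 3, X 5, X 6, X 7] (fun t => ?_) ?_
  · funext k
    fin_cases k <;> simp [polyMap]
    ring
  · ext p
    constructor
    · rintro ⟨k, d, α, β, γ, rfl⟩
      refine ⟨![k, d, α, β, γ], vec8_ext ?_ ?_ ?_ ?_ ?_ ?_ ?_ ?_⟩ <;> simp [polyMap]
    · rintro ⟨t, rfl⟩
      refine ⟨t 0, t 1, t 2, t 3, t 4, vec8_ext ?_ ?_ ?_ ?_ ?_ ?_ ?_ ?_⟩ <;> simp [polyMap]

theorem isPolyGraph_leftCubeLinearFamily : IsPolyGraph (Fin 4) leftCubeLinearFamily := by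
  refine isPolyGraph_of_leftInverse ![X 0, 0, 0, 0, 0, X 1, X 2, X 3]
    ![X 0, X 5, X 6, X 7] (fun t => ?_) ?_
  · funext k
    fin_cases k <;> simp [polyMap]
  · ext p
    constructor
    · rintro ⟨a, α, β, γ, rfl⟩
      refine ⟨![a, α, β, γ], vec8_ext ?_ ?_ ?_ ?_ ?_ ?_ ?_ ?_⟩ <;> simp [polyMap]
    · rintro ⟨t, rfl⟩
      refine ⟨t 0, t 1, t 2, t 3, vec8_ext ?_ ?_ ?_ ?_ ?_ ?_ ?_ ?_⟩ <;> simp [polyMap]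

theorem isPolyGraph_rightCubeLinearFamily : IsPolyGraph (Fin 4) rightCubeLinearFamily := by
  refine isPolyGraph_of_leftInverse ![X 0, 3 * X 0, 3 * X 0, X 0, 0, X 1, X 2, X 3]
    ![X 0, X 5, X 6, X 7] (fun t => ?_) ?_
  · funext k
    fin_cases k <;> simp [polyMap]
  · ext p
    constructor
    · rintro ⟨a, α, β, γ, rfl⟩
      refine ⟨![a, α, β, γ], vec8_ext ?_ ?_ ?_ ?_ ?_ ?_ ?_ ?_⟩ <;> simp [polyMap]
    · rintro ⟨t, rfl⟩
      refine ⟨t 0, t 1, t 2, t 3, vec8_ext ?_ ?_ ?_ ?_ ?_ ?_ ?_ ?_⟩ <;> simp [polyMap]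

theorem exists_isPolyGraph_component (i : Fin 10) : ∃ n, IsPolyGraph (Fin n) (component i) := by
  fin_cases i
  exacts [⟨3, isPolyGraph_transverseFamily⟩, ⟨4, isPolyGraph_mainFamily⟩,
    ⟨3, isPolyGraph_leftHalfFamily⟩, ⟨3, isPolyGraph_rightHalfFamily⟩,
    ⟨2, isPolyGraph_leftCubeFamily⟩, ⟨2, isPolyGraph_midCubeFamily⟩,
    ⟨2, isPolyGraph_rightCubeFamily⟩, ⟨5, isPolyGraph_hypergeomFamily⟩,
    ⟨4, isPolyGraph_leftCubeLinearFamily⟩, ⟨4, isPolyGraph_rightCubeLinearFamily⟩]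

theorem continuous_permExponents (π : Equiv.Perm (Fin 3)) :
    @Continuous _ _ (zariski (Fin 8)) (zariski (Fin 8)) (permExponents π) := by
  let e : Fin 3 → MvPolynomial (Fin 8) ℂ := ![X 5, X 6, X 7]
  have he : ∀ p i, aeval p (e i) = exponents p i := by
    intro p i
    fin_cases i <;> simp [e, exponents]
  have h : permExponents π = polyMap ![X 0, X 1, X 2, X 3, X 4, e (π 0), e (π 1), e (π 2)] := by
    funext p i
    fin_cases i <;> simp [polyMap, permExponents, he]
  rw [h]
  exact continuous_polyMap _

theorem isIrreducible_perm_component (i : Fin 10) (π : Equiv.Perm (Fin 3)) :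
    @IsIrreducible _ (zariski (Fin 8)) (permExponents π '' component i) := by
  obtain ⟨n, hn⟩ := exists_isPolyGraph_component i
  let _ := zariski (Fin 8)
  exact hn.isIrreducible.image _ (continuous_permExponents π).continuousOn

theorem isClosed_perm_component (i : Fin 10) (π : Equiv.Perm (Fin 3)) :
    IsClosed[zariski (Fin 8)] (permExponents π '' component i) := by
  obtain ⟨n, hn⟩ := exists_isPolyGraph_component i
  let _ := zariski (Fin 8)
  rw [permExponents_image_eq_preimage]
  exact hn.isClosed.preimage (continuous_permExponents π⁻¹)

/-! ### No component contains another one -/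

/-- Conditions that hold on all relabellings of the `i`-th component and single it out. -/
def componentInvariant (i : Fin 10) (p : Fin 8 → ℂ) : Prop :=
  (![4 * p 4 = p 0 ^ 2, p 5 + p 6 + p 7 = 3 ∧ 3 * p 0 = 2 * p 1, p 5 + p 6 + p 7 = 3 / 2,
    p 5 + p 6 + p 7 = 9 / 2, p 5 + p 6 + p 7 = 0, p 5 + p 6 + p 7 = 3 ∧ p 5 * p 6 * p 7 = 1,
    p 5 + p 6 + p 7 = 6, p 4 = 0 ∧ 3 * p 0 = 2 * p 1, p 4 = 0 ∧ p 1 = 0, p 4 = 0 ∧ p 1 = 3 * p 0] :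
    Fin 10 → Prop) i

theorem componentInvariant_permExponents (i : Fin 10) (π : Equiv.Perm (Fin 3)) (p : Fin 8 → ℂ) :
    componentInvariant i (permExponents π p) = componentInvariant i p := by
  rw [componentInvariant, exponents_sum_perm, exponents_prod_perm]
  rfl

theorem componentInvariant_of_mem {i : Fin 10} {p : Fin 8 → ℂ} (hp : p ∈ component i) :
    componentInvariant i p := by
  fin_cases i
  · obtain ⟨a, α, β, rfl⟩ := hp
    simp [componentInvariant]
    ring
  · obtain ⟨c, d, f, α, rfl⟩ := hp
    simp [componentInvariant]
    exact ⟨by ring, by ring⟩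
  · obtain ⟨m, k, α, rfl⟩ := hp
    simp [componentInvariant]
    ring
  · obtain ⟨m, k, α, rfl⟩ := hp
    simp [componentInvariant]
    ring
  · obtain ⟨a, f, rfl⟩ := hp
    simp [componentInvariant]
  · obtain ⟨m, n, rfl⟩ := hp
    simp [componentInvariant]
    norm_num
  · obtain ⟨a, f, rfl⟩ := hp
    simp [componentInvariant]
    norm_num
  · obtain ⟨k, d, α, β, γ, rfl⟩ := hp
    simp [componentInvariant]
    ring
  · obtain ⟨a, α, β, γ, rfl⟩ := hp
    simp [componentInvariant]
  · obtain ⟨a, α, β, γ, rfl⟩ := hp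
    simp [componentInvariant]

/-- A point of the `i`-th component that lies on no relabelling of another component. -/
noncomputable def witnessPoint : Fin 10 → Fin 8 → ℂ :=
  ![![4, 90, 430, 200, 4, 10, 15, 20], ![0, 0, 2, 1, 1, 0, 1, 2], ![3, 3, 1, 0, 2, 0, 1 / 2, 1],
    ![3, 6, 4, 1, 2, 1, 3 / 2, 2], ![0, 0, 0, 0, 1, 0, 0, 0], ![3, 3, 3, 1, 2, 1, 1, 1],
    ![0, 0, 0, 0, 1, 2, 2, 2], ![2, 3, 1, 0, 0, 10, 10, 10], ![1, 0, 0, 0, 0, 10, 10, 10],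
    ![1, 3, 3, 1, 0, 10, 10, 10]]

theorem witnessPoint_mem (i : Fin 10) : witnessPoint i ∈ component i := by
  fin_cases i
  · exact ⟨4, 10, 20, by simp [witnessPoint]; norm_num⟩
  · exact ⟨2, 1, 1, 0, by simp [witnessPoint]⟩
  · exact ⟨1, 1, 0, by simp [witnessPoint]; norm_num⟩
  · exact ⟨1, 1, 1, by simp [witnessPoint]; norm_num⟩
  · exact ⟨0, 1, by simp [witnessPoint]⟩
  · exact ⟨2, 1, by simp [witnessPoint]; norm_num⟩
  · exact ⟨0, 1, by simp [witnessPoint]⟩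
  · exact ⟨1, 0, 10, 10, 10, by simp [witnessPoint]⟩
  · exact ⟨1, 10, 10, 10, by simp [witnessPoint]⟩
  · exact ⟨1, 10, 10, 10, by simp [witnessPoint]⟩

/-- Where the sum of exponents is free, the witness has a sum (`30` or `45`) different from all the
fixed values `0, 3/2, 3, 9/2, 6`. -/
theorem eq_of_componentInvariant_witnessPoint {i j : Fin 10}
    (h : componentInvariant j (witnessPoint i)) : i = j := by
  by_contra hij
  fin_cases i <;> fin_cases j <;>
    first
    | exact hij rfl
    | (simp [componentInvariant, witnessPoint] at h <;> norm_num at h)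

theorem eq_of_perm_component_subset {i j : Fin 10} {π ρ : Equiv.Perm (Fin 3)}
    (h : permExponents π '' component i ⊆ permExponents ρ '' component j) : i = j := by
  obtain ⟨q, hq, hqe⟩ := h (Set.mem_image_of_mem _ (witnessPoint_mem i))
  apply eq_of_componentInvariant_witnessPoint
  rw [← componentInvariant_permExponents j π, ← hqe, componentInvariant_permExponents]
  exact componentInvariant_of_mem hq

/-- Iterating `Z ⊆ πZ` gives `πZ ⊆ π²Z ⊆ …`, and the chain reaches `Z` at the order of `π`. -/
theorem perm_image_subset_of_subset {Z : Set (Fin 8 → ℂ)} {π : Equiv.Perm (Fin 3)}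
    (h : Z ⊆ permExponents π '' Z) : permExponents π '' Z ⊆ Z := by
  have hpow : ∀ n : ℕ, permExponents π '' Z ⊆ permExponents (π ^ (n + 1)) '' Z := by
    intro n
    induction n with
    | zero => simp
    | succ n ih =>
      refine ih.trans ?_
      rw [pow_succ' π (n + 1), ← permExponents_image_image]
      exact Set.image_mono h
  have h' := hpow (orderOf π - 1)
  rwa [Nat.sub_add_cancel (orderOf_pos π), pow_orderOf_eq_one, permExponents_one_image] at h'

theorem perm_component_subset_of_subset {i : Fin 10} {π ρ : Equiv.Perm (Fin 3)}
    (h : permExponents π '' component i ⊆ permExponents ρ '' component i) :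
    permExponents ρ '' component i ⊆ permExponents π '' component i := by
  have h1 := Set.image_mono (f := permExponents π⁻¹) h
  rw [permExponents_image_image, permExponents_image_image, mul_inv_cancel,
    permExponents_one_image] at h1
  have h2 := Set.image_mono (f := permExponents π) (perm_image_subset_of_subset h1)
  rwa [permExponents_image_image, inv_mul_cancel_right] at h2

/-! ### The irreducible components of `Y` and the main theorem -/

theorem irredComponents_Y : irredComponents Y =
    Set.range fun x : Fin 10 × Equiv.Perm (Fin 3) => permExponents x.2 '' component x.1 := by
  rw [Y_eq_iUnion]
  refine irredComponents_iUnion _ (fun x => isIrreducible_perm_component x.1 x.2)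
    (fun x => isClosed_perm_component x.1 x.2) ?_
  rintro ⟨i, π⟩ ⟨j, ρ⟩ h
  obtain rfl := eq_of_perm_component_subset h
  exact perm_component_subset_of_subset h

theorem isClosed_Y : IsClosed[zariski (Fin 8)] Y := by
  let _ := zariski (Fin 8)
  rw [Y_eq_iUnion]
  exact isClosed_iUnion_of_finite fun x => isClosed_perm_component x.1 x.2

end CYThird

theorem mainTheorem2 :
    ∃ C : Fin 10 → Set (Fin 8 → ℂ),
      -- `Y` is an algebraic set, and the union of its irreducible components
      (∃ I : Ideal (MvPolynomial (Fin 8) ℂ), CYThird.Y = MvPolynomial.zeroLocus ℂ I) ∧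
      CYThird.Y = ⋃₀ CYThird.irredComponents CYThird.Y ∧
      -- up to relabelling `α, β, γ` the irreducible components are exactly `C 0, …, C 9`
      (∀ i, C i ∈ CYThird.irredComponents CYThird.Y) ∧
      (∀ Z ∈ CYThird.irredComponents CYThird.Y,
        ∃! i, ∃ π : Equiv.Perm (Fin 3), Z = CYThird.permExponents π '' C i) ∧
      -- relabelling permutes the irreducible components
      (∀ Z ∈ CYThird.irredComponents CYThird.Y, ∀ π : Equiv.Perm (Fin 3),
        CYThird.permExponents π '' Z ∈ CYThird.irredComponents CYThird.Y) ∧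
      -- exactly seven of the ten are not contained in `f = 0`
      (∀ i, (∃ p ∈ C i, p 4 ≠ 0) ↔ i < 7) ∧
      -- the transverse component: `σ` is not fixed
      C 0 = CYThird.transverseFamily ∧
      (¬ ∃ s : ℂ, ∀ p ∈ C 0, p 4 ≠ 0 → CYThird.sigma p = s) ∧ CYThird.algDim (C 0) = 3 ∧
      -- the main component
      C 1 = CYThird.mainFamily ∧
      -- the six components with fixed `σ`, and their dimensions
      (∀ p ∈ C 1, CYThird.sigma p = 2) ∧ CYThird.algDim (C 1) = 4 ∧
      (∀ p ∈ C 2, CYThird.sigma p = 1) ∧ CYThird.algDim (C 2) = 3 ∧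
      (∀ p ∈ C 3, CYThird.sigma p = 3) ∧ CYThird.algDim (C 3) = 3 ∧
      (∀ p ∈ C 4, CYThird.sigma p = 0) ∧ CYThird.algDim (C 4) = 2 ∧
      (∀ p ∈ C 5, CYThird.sigma p = 2) ∧ CYThird.algDim (C 5) = 2 ∧
      (∀ p ∈ C 6, CYThird.sigma p = 4) ∧ CYThird.algDim (C 6) = 2 := by
  open CYThird in
  refine ⟨component, isClosed_zariski_iff.1 isClosed_Y, ?_, ?_, ?_, ?_, ?_, rfl, ?_,
    by simpa using IsPolyGraph.algDim_eq (Z := component 0) isPolyGraph_transverseFamily, rfl,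
    ?_, by simpa using IsPolyGraph.algDim_eq (Z := component 1) isPolyGraph_mainFamily,
    ?_, by simpa using IsPolyGraph.algDim_eq (Z := component 2) isPolyGraph_leftHalfFamily,
    ?_, by simpa using IsPolyGraph.algDim_eq (Z := component 3) isPolyGraph_rightHalfFamily,
    ?_, by simpa using IsPolyGraph.algDim_eq (Z := component 4) isPolyGraph_leftCubeFamily,
    ?_, by simpa using IsPolyGraph.algDim_eq (Z := component 5) isPolyGraph_midCubeFamily,
    ?_, by simpa using IsPolyGraph.algDim_eq (Z := component 6) isPolyGraph_rightCubeFamily⟩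
  · rw [irredComponents_Y, Set.sUnion_range]
    exact Y_eq_iUnion
  · intro i
    rw [irredComponents_Y]
    exact ⟨(i, 1), permExponents_one_image _⟩
  · intro Z hZ
    rw [irredComponents_Y] at hZ
    obtain ⟨⟨i, π⟩, rfl⟩ := hZ
    refine ⟨i, ⟨π, rfl⟩, ?_⟩
    rintro j ⟨ρ, hρ⟩
    exact eq_of_perm_component_subset hρ.ge
  · intro Z hZ π
    rw [irredComponents_Y] at hZ ⊢
    obtain ⟨⟨i, ρ⟩, rfl⟩ := hZ
    exact ⟨(i, ρ * π), (permExponents_image_image _ _ _).symm⟩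
  · intro i
    constructor
    · rintro ⟨p, hp, hp4⟩
      by_contra hi
      refine hp4 ?_
      -- For the last three families the first clause of the invariant is `p 4 = 0`.
      have h := componentInvariant_of_mem hp
      fin_cases i <;> first | exact absurd (by decide) hi | exact h.1
    · intro hi
      refine ⟨witnessPoint i, witnessPoint_mem i, ?_⟩
      fin_cases i <;> first | exact absurd hi (by decide) | simp [witnessPoint]
  · rintro ⟨s, hs⟩
    -- Both points have `f = 1`, but `σ = 0` at the first and `σ = 2` at the second.
    have h1 := hs _ ⟨2, 0, 0, rfl⟩ (by simp)
    have h2 := hs _ ⟨2, 1, 1, rfl⟩ (by simp)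
    rw [← h2] at h1
    simp [sigma] at h1
    norm_num at h1
  · rintro _ ⟨c, d, f, α, rfl⟩
    simp [sigma]
    ring
  · rintro _ ⟨m, k, α, rfl⟩
    simp [sigma]
    ring
  · rintro _ ⟨m, k, α, rfl⟩
    simp [sigma]
    ring
  · rintro _ ⟨a, f, rfl⟩
    simp [sigma]
  · rintro _ ⟨m, n, rfl⟩
    simp [sigma]
    norm_num
  · rintro _ ⟨a, f, rfl⟩
    simp [sigma]
    norm_num
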